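/- Let $d\ge 2$ and let $\mathcal{E}=\{\pm e_i : i=1,\dots,d\}$ be the set of unit vectors of $\mathbb{Z}^d$. Let $\mu$ be an arbitrary probability measure on the space $M_1(\mathcal{E})$ of probability measures on $\mathcal{E}$; no ellipticity is assumed. Let the environment $\omega=(\omega_x)_{x\in\mathbb{Z}^d}$ be i.i.d. with law $\mu$, that is, $\omega$ has law $\nu=\mu^{\otimes\mathbb{Z}^d}$ on $M_1(\mathcal{E})^{\mathbb{Z}^d}$. Given $\omega$, let $\mathbb{P}_\omega$ be the law of the Markov chain $(X_n)_{n\ge 0}$ on $\mathbb{Z}^d$ with $X_0=0$ and transition probabilities $p_\omega(x,x+e)=\omega_x(\{e\})$ for $x\in\mathbb{Z}^d$, $e\in\mathcal{E}$, and let $P(\cdot)=\int \mathbb{P}_\omega(\cdot)\,d\nu(\omega)$ be the annealed law. Then for every $\ell\in\mathbb{R}^d\setminus\{0\}$, with $A_+=\{X_n\cdot\ell\to+\infty\}$ and $A_-=\{X_n\cdot\ell\to-\infty\}$ (as $n\to\infty$), $$P(A_+\cup A_-)\in\{0,1\}.$$ -/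

import Mathlib

open MeasureTheory ProbabilityTheory Filter

noncomputable section

namespace RWRE

/-- The lattice `ℤ^d`. -/
abbrev Lattice (d : ℕ) : Type := Fin d → ℤ

/-- Index set of the `2d` unit vectors of `ℤ^d`: `(i, true)` stands for `e_i` and
`(i, false)` for `-e_i`. -/
abbrev Dir (d : ℕ) : Type := Fin d × Bool

/-- The unit vector of `ℤ^d` that an element of `Dir d` stands for. -/
def Dir.vec {d : ℕ} (e : Dir d) : Lattice d :=
  if e.2 then Pi.single e.1 1 else -Pi.single e.1 1

/-- Environments: a probability measure on the `2d` unit vectors at each site of `ℤ^d`, with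
the product σ-algebra. -/
abbrev Env (d : ℕ) : Type := Lattice d → ProbabilityMeasure (Dir d)

/-- The law of the i.i.d. environment with marginal `μ`: the product measure `μ^{⊗ ℤ^d}`. -/
def envLaw {d : ℕ} (μ : Measure (ProbabilityMeasure (Dir d))) [IsProbabilityMeasure μ] :
    Measure (Env d) :=
  Measure.infinitePi fun _ : Lattice d => μ

/-- The transition kernel of the walk in the environment `ω`: from `x` it jumps to `x + e` with
probability `ω x {e}`. -/
def stepKernel {d : ℕ} (ω : Env d) : Kernel (Lattice d) (Lattice d) where
  toFun x := (ω x : Measure (Dir d)).map fun e => x + e.vec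
  measurable' := measurable_of_countable _

instance {d : ℕ} (ω : Env d) : IsMarkovKernel (stepKernel ω) :=
  ⟨fun _ => Measure.isProbabilityMeasure_map (measurable_of_countable _).aemeasurable⟩

theorem stepKernel_apply {d : ℕ} (ω : Env d) (x : Lattice d) :
    stepKernel ω x = (ω x : Measure (Dir d)).map fun e => x + e.vec := rfl

/-- The kernel giving the position at time `n + 1` from the positions up to time `n`: it only
looks at the position at time `n`. -/
def histKernel {d : ℕ} (ω : Env d) (n : ℕ) :
    Kernel ((i : Finset.Iic n) → (fun _ : ℕ => Lattice d) i) (Lattice d) :=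
  (stepKernel ω).comap (fun h => h ⟨n, Finset.mem_Iic.2 le_rfl⟩) (measurable_pi_apply _)

instance {d : ℕ} (ω : Env d) (n : ℕ) : IsMarkovKernel (histKernel ω n) := by
  unfold histKernel; infer_instance

/-- The quenched law: the law on path space `ℕ → ℤ^d` of the Markov chain with transition kernel
`stepKernel ω`, started at the origin. -/
def quenched {d : ℕ} (ω : Env d) : Measure (ℕ → Lattice d) :=
  Kernel.traj (X := fun _ => Lattice d) (histKernel ω) 0 fun _ => 0

instance {d : ℕ} (ω : Env d) : IsProbabilityMeasure (quenched ω) := by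
  unfold quenched; infer_instance

theorem measurable_stepKernel_apply {d : ℕ} (x : Lattice d) :
    Measurable fun ω : Env d => stepKernel ω x := by
  simp only [stepKernel_apply]
  exact (Measure.measurable_map _ (measurable_of_countable _)).comp
    (measurable_subtype_coe.comp (measurable_pi_apply x))

theorem measurable_partialTraj {d : ℕ} (n : ℕ)
    (x : (i : Finset.Iic 0) → (fun _ : ℕ => Lattice d) i) :
    Measurable fun ω : Env d =>
      Kernel.partialTraj (X := fun _ => Lattice d) (histKernel ω) 0 n x := by
  induction n with
  | zero => simp only [Kernel.partialTraj_self]; exact measurable_const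
  | succ n ih =>
    refine Measure.measurable_of_measurable_coe _ fun s hs => ?_
    simp only [Kernel.partialTraj_succ_eq_comp (Nat.zero_le n)]
    simp only [Kernel.comp_apply' _ _ _ hs]
    simp only [lintegral_countable']
    refine Measurable.tsum fun y => ?_
    refine Measurable.mul ?_ ((Measure.measurable_coe (measurableSet_singleton y)).comp ih)
    simp only [Kernel.partialTraj_succ_self]
    have hm := measurable_IicProdIoc (X := fun _ : ℕ => Lattice d) (m := n) (n := n + 1)
    simp only [Kernel.map_apply' _ hm _ hs, Kernel.id_prod_apply' _ _ (hm hs)]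
    have hp := (MeasurableEquiv.piSingleton (X := fun _ : ℕ => Lattice d) n).measurable
    simp only [Kernel.map_apply' _ hp _ (measurable_prodMk_left (hm hs))]
    exact (Measure.measurable_coe (hp (measurable_prodMk_left (hm hs)))).comp
      (measurable_stepKernel_apply _)

/-- The quenched law depends measurably on the environment, so that the annealed law below is a
genuine average. -/
theorem measurable_quenched {d : ℕ} : Measurable (quenched (d := d)) := by
  refine Measurable.measure_of_isPiSystem_of_isProbabilityMeasure
    (S := measurableCylinders fun _ : ℕ => Lattice d)
    generateFrom_measurableCylinders.symm isPiSystem_measurableCylinders fun s hs => ?_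
  obtain ⟨n, S, hS, rfl⟩ : ∃ n : ℕ, ∃ S : Set ((i : Finset.Iic n) → Lattice d),
      MeasurableSet S ∧ s = cylinder (Finset.Iic n) S := by
    obtain ⟨I, S, hS, rfl⟩ := (mem_measurableCylinders _).1 hs
    have hI : I ⊆ Finset.Iic (I.sup id) := fun i hi =>
      Finset.mem_Iic.2 (Finset.le_sup (f := id) hi)
    exact ⟨I.sup id, Finset.restrict₂ (π := fun _ : ℕ => Lattice d) hI ⁻¹' S,
      Finset.measurable_restrict₂ (X := fun _ : ℕ => Lattice d) hI hS, rfl⟩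
  have h : ∀ ω : Env d, quenched ω (cylinder (Finset.Iic n) S)
      = Kernel.partialTraj (X := fun _ => Lattice d) (histKernel ω) 0 n (fun _ => 0) S := by
    intro ω
    rw [← Kernel.traj_map_frestrictLe_apply,
      Measure.map_apply (Preorder.measurable_frestrictLe n) hS]
    rfl
  simp only [h]
  exact (Measure.measurable_coe hS).comp (measurable_partialTraj n _)

/-- The annealed law on path space, `P(A) = ∫ quenched ω A dν(ω)`, where `ν = envLaw μ`. -/
def annealed {d : ℕ} (μ : Measure (ProbabilityMeasure (Dir d))) [IsProbabilityMeasure μ] :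
    Measure (ℕ → Lattice d) :=
  (envLaw μ).bind quenched

/-- The inner product `x · ℓ` of a lattice point with a real vector. -/
def dot {d : ℕ} (x : Lattice d) (ℓ : Fin d → ℝ) : ℝ := ∑ i, (x i : ℝ) * ℓ i

/-- The event `A_+` that `X_n · ℓ → +∞`. -/
def eventPlus {d : ℕ} (ℓ : Fin d → ℝ) : Set (ℕ → Lattice d) :=
  {X | Tendsto (fun n => dot (X n) ℓ) atTop atTop}

/-- The event `A_-` that `X_n · ℓ → -∞`. -/
def eventMinus {d : ℕ} (ℓ : Fin d → ℝ) : Set (ℕ → Lattice d) :=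
  {X | Tendsto (fun n => dot (X n) ℓ) atTop atBot}

end RWRE

end

open MeasureTheory ProbabilityTheory Filter

/-! Replacing `ℓ` by `-ℓ` if necessary, it suffices to show that if `A_+` has positive probability,
then `A_+ ∪ A_-` has probability one. Of the annealed law only `StartsAfresh` is used, and Lévy's
0-1 law turns infinitely many fresh attempts with a fixed positive chance into an almost sure
success (`ae_exists_mem_of_frequently`).

Write `φ = · · ℓ`. On `A_+` the path attains a minimum of `φ`, so the walk has a positive chance of
staying in `{φ ≥ 0}`. Each new record of `φ` is a fresh attempt to do so; hence unboundedness above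
forces `φ → +∞` (`ae_tendsto_of_not_bddAbove`).

Suppose now that `φ` is bounded above. Transient trajectories supply a possible finite path that
climbs as high as desired and stays in a lexicographic half-space for `(φ, ψ)`. If the walk were
unbounded in direction `ψ` within a strip, records of `φ + εψ` there would be fresh attempts to
follow this path, and one success would exceed the bound (`ae_bddAbove_strip`). With `ψ` ranging
over the signed coordinates, only finitely many sites are visited above each level. If `φ` does not
tend to `-∞`, its maximum is therefore attained. Boundedness below would make the range finite,
contrary to `ae_infinite_range`; unboundedness below forces `φ → -∞` by the half-space argument for
`-φ`. -/

namespace RWRE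

/-! ### Cylinder events and a conditional 0-1 law on path space -/

section PathSpace

variable {V : Type*}

/-- The paths that agree with `x` up to time `n`. -/
def cyl (n : ℕ) (x : ℕ → V) : Set (ℕ → V) := {X | ∀ i ≤ n, X i = x i}

/-- The paths that never leave `H`. -/
def stay (H : Set V) : Set (ℕ → V) := {X | ∀ j, X j ∈ H}

/-- The set `C` of paths depends on the positions up to time `n` only. -/
def Determined (n : ℕ) (C : Set (ℕ → V)) : Prop :=
  ∀ X Y : ℕ → V, (∀ i ≤ n, X i = Y i) → X ∈ C → Y ∈ C

/-- The path seen from its position at time `n`, from that time on. -/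
def shift [AddCommGroup V] (n : ℕ) (X : ℕ → V) : ℕ → V := fun j => X (n + j) - X n

theorem cyl_eq_preimage (n : ℕ) (x : ℕ → V) :
    cyl n x = Preorder.frestrictLe (π := fun _ : ℕ => V) n ⁻¹' {Preorder.frestrictLe n x} := by
  ext X
  simp only [cyl, Set.mem_ofPred_eq, Set.mem_preimage, Set.mem_singleton_iff, funext_iff,
    Preorder.frestrictLe_apply, Subtype.forall, Finset.mem_Iic]

theorem Determined.inter {n : ℕ} {C D : Set (ℕ → V)} (hC : Determined n C)
    (hD : Determined n D) : Determined n (C ∩ D) :=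
  fun X Y hXY h => ⟨hC X Y hXY h.1, hD X Y hXY h.2⟩

theorem Determined.preimage_image {n : ℕ} {C : Set (ℕ → V)} (hC : Determined n C) :
    Preorder.frestrictLe (π := fun _ : ℕ => V) n ⁻¹' (Preorder.frestrictLe n '' C) = C := by
  refine (Set.subset_preimage_image _ _).antisymm' ?_
  rintro Y ⟨X, hX, hXY⟩
  exact hC X Y (fun i hi => congrFun hXY ⟨i, Finset.mem_Iic.2 hi⟩) hX

theorem measurableSet_cyl [MeasurableSpace V] [MeasurableSingletonClass V] (n : ℕ) (x : ℕ → V) : MeasurableSet (cyl n x) := by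
  rw [cyl_eq_preimage]
  exact Preorder.measurable_frestrictLe n (measurableSet_singleton _)

theorem determined_of_measurableSet_piLE [MeasurableSpace V] {n : ℕ} {C : Set (ℕ → V)}
    (hC : MeasurableSet[Filtration.piLE (X := fun _ : ℕ => V) n] C) : Determined n C := by
  rw [Filtration.piLE_eq_comap_frestrictLe] at hC
  obtain ⟨S, -, rfl⟩ := hC
  intro X Y h hX
  have : Preorder.frestrictLe (π := fun _ : ℕ => V) n X = Preorder.frestrictLe n Y :=
    funext fun i => h i (Finset.mem_Iic.1 i.2)
  rwa [Set.mem_preimage, ← this]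

variable [MeasurableSpace V] [MeasurableSingletonClass V] [Countable V]

theorem measurableSet_stay (H : Set V) : MeasurableSet (stay H) := by
  simp only [stay, Set.ofPred_forall]
  exact .iInter fun j => measurable_pi_apply j H.to_countable.measurableSet

theorem Determined.measurableSet_piLE {n : ℕ} {C : Set (ℕ → V)} (hC : Determined n C) :
    MeasurableSet[Filtration.piLE (X := fun _ : ℕ => V) n] C := by
  rw [Filtration.piLE_eq_comap_frestrictLe]
  exact ⟨_, (Set.to_countable _).measurableSet, hC.preimage_image⟩

theorem Determined.measurableSet {n : ℕ} {C : Set (ℕ → V)} (hC : Determined n C) :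
    MeasurableSet C :=
  Filtration.piLE.le n _ hC.measurableSet_piLE

/-- Since `V` is countable, `C` is a countable disjoint union of cylinders. Inequalities, and hence
equalities, between measures can thus be checked on cylinders. -/
theorem measure_le_of_determined {κ κ' : Measure (ℕ → V)} {n : ℕ} {C : Set (ℕ → V)}
    (hC : Determined n C) (h : ∀ x ∈ C, κ (cyl n x) ≤ κ' (cyl n x)) : κ C ≤ κ' C := by
  have key : ∀ ρ : Measure (ℕ → V), ρ C = ∑' a : (Preorder.frestrictLe n '' C :
      Set ((i : Finset.Iic n) → V)), ρ (Preorder.frestrictLe (π := fun _ : ℕ => V) n ⁻¹' {↑a}) := by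
    intro ρ
    rw [tsum_measure_preimage_singleton (Set.to_countable _), hC.preimage_image]
    exact fun y _ => Preorder.measurable_frestrictLe n (measurableSet_singleton _)
  rw [key, key]
  refine ENNReal.tsum_le_tsum ?_
  rintro ⟨_, x, hx, rfl⟩
  simpa only [cyl_eq_preimage] using h x hx

/-- The event is the decreasing limit of the events of staying up to time `m`, each of which is
determined at time `m`. -/
theorem measure_stay_le {κ κ' : Measure (ℕ → V)} [IsFiniteMeasure κ] [IsFiniteMeasure κ']
    {H : Set V} (h : ∀ m y, (∀ j ≤ m, y j ∈ H) → κ (cyl m y) ≤ κ' (cyl m y)) :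
    κ (stay H) ≤ κ' (stay H) := by
  set E : ℕ → Set (ℕ → V) := fun m => {X | ∀ j ≤ m, X j ∈ H} with hE
  have hdet : ∀ m, Determined m (E m) := fun m X Y hXY hX j hj => hXY j hj ▸ hX j hj
  have hstay : stay H = ⋂ m, E m := by
    ext X
    simp only [stay, hE, Set.mem_ofPred_eq, Set.mem_iInter]
    exact ⟨fun hX m j _ => hX j, fun hX j => hX j j le_rfl⟩
  have hanti : Antitone E := fun a b hab X hX j hj => hX j (hj.trans hab)
  have hlim : ∀ ρ : Measure (ℕ → V), IsFiniteMeasure ρ →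
      Tendsto (fun m => ρ (E m)) atTop (nhds (ρ (stay H))) := by
    intro ρ _
    rw [hstay]
    exact tendsto_measure_iInter_atTop (fun m => (hdet m).measurableSet.nullMeasurableSet)
      hanti ⟨0, measure_ne_top _ _⟩
  exact le_of_tendsto_of_tendsto' (hlim κ inferInstance) (hlim κ' inferInstance) fun m =>
    measure_le_of_determined (hdet m) (h m)

theorem iSup_piLE : ⨆ n, Filtration.piLE (X := fun _ : ℕ => V) n = MeasurableSpace.pi := by
  refine le_antisymm (iSup_le fun n => Filtration.piLE.le n) (iSup_le fun n => ?_)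
  rintro _ ⟨S, -, rfl⟩
  refine le_iSup (fun n => Filtration.piLE (X := fun _ : ℕ => V) n) n _
    (Determined.measurableSet_piLE fun X Y h hX => ?_)
  rwa [Set.mem_preimage, ← h n le_rfl]

/-- If at each of the times `n` singled out by `T n` the event `D n` has conditional probability
`c > 0` given the past, then almost surely one of them succeeds if there are infinitely many. -/
theorem ae_exists_mem_of_frequently {P : Measure (ℕ → V)} [IsProbabilityMeasure P]
    {T D : ℕ → Set (ℕ → V)} {c : ENNReal} (hc : c ≠ 0) (hT : ∀ n, Determined n (T n))
    (hD : ∀ n, MeasurableSet (D n))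
    (h : ∀ n, ∀ x ∈ T n, P (cyl n x ∩ D n) = P (cyl n x) * c) :
    ∀ᵐ X ∂P, (∃ᶠ n in atTop, X ∈ T n) → ∃ n, X ∈ T n ∩ D n := by
  by_cases hne : ∃ n, P (T n) ≠ 0
  swap
  · push Not at hne
    filter_upwards [ae_all_iff.2 fun n => measure_eq_zero_iff_ae_notMem.1 (hne n)] with X hX hf
    exact absurd hf (by simp [hX])
  have hmul : ∀ n C, Determined n C → C ⊆ T n → P (C ∩ D n) = P C * c := by
    intro n C hC hCT
    have h1 : ∀ x ∈ C, P.restrict (D n) (cyl n x) = (c • P) (cyl n x) := by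
      intro x hx
      rw [Measure.restrict_apply (measurableSet_cyl n x), h n x (hCT hx), Measure.smul_apply,
        smul_eq_mul, mul_comm]
    have h2 : P.restrict (D n) C = (c • P) C :=
      le_antisymm (measure_le_of_determined hC fun x hx => (h1 x hx).le)
        (measure_le_of_determined hC fun x hx => (h1 x hx).ge)
    rwa [Measure.restrict_apply hC.measurableSet, Measure.smul_apply, smul_eq_mul,
      mul_comm] at h2
  -- The value `⊤` would give some `T n ∩ D n` infinite mass, as some `T n` is not null.
  have hctop : c ≠ ⊤ := by
    rintro rfl
    obtain ⟨n, hn⟩ := hne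
    have := hmul n _ (hT n) subset_rfl
    rw [ENNReal.mul_top hn] at this
    exact measure_ne_top _ _ this
  have hc' : 0 < c.toReal := ENNReal.toReal_pos hc hctop
  set S : Set (ℕ → V) := ⋃ n, T n ∩ D n with hS
  have hSm : MeasurableSet S := .iUnion fun n => (hT n).measurableSet.inter (hD n)
  have hint : Integrable (S.indicator fun _ => (1 : ℝ)) P := (integrable_const _).indicator hSm
  -- Lévy's upward theorem: the conditional probabilities of `S` tend to its indicator. They are at
  -- least `c` whenever `T n` occurs, so infinitely many occurrences exclude the limit `0`.
  have hlevy := hint.tendsto_ae_condExp (ℱ := Filtration.piLE) (by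
    rw [iSup_piLE]; exact stronglyMeasurable_const.indicator hSm)
  have hbound : ∀ n, ∀ᵐ X ∂P, X ∈ T n →
      c.toReal ≤ (P[S.indicator fun _ => (1 : ℝ) | Filtration.piLE (X := fun _ : ℕ => V) n]) X := by
    intro n
    have hTDm := (hT n).measurableSet.inter (hD n)
    have hint' : Integrable ((T n ∩ D n).indicator fun _ => (1 : ℝ)) P :=
      (integrable_const _).indicator hTDm
    have heq : (T n).indicator (fun _ => c.toReal) =ᵐ[P]
        P[(T n ∩ D n).indicator fun _ => (1 : ℝ) | Filtration.piLE (X := fun _ : ℕ => V) n] := by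
      refine ae_eq_condExp_of_forall_setIntegral_eq (Filtration.piLE.le n) hint' ?_ ?_ ?_
      · exact fun s _ _ => ((integrable_const _).indicator (hT n).measurableSet).integrableOn
      · intro s hs _
        have hs' := determined_of_measurableSet_piLE hs
        rw [setIntegral_indicator (hT n).measurableSet, setIntegral_indicator hTDm,
          setIntegral_const, setIntegral_const, smul_eq_mul, smul_eq_mul, mul_one,
          ← Set.inter_assoc, Measure.real, Measure.real,
          hmul n _ (hs'.inter (hT n)) Set.inter_subset_right, ENNReal.toReal_mul]
      · exact (stronglyMeasurable_const.indicator (hT n).measurableSet_piLE).aestronglyMeasurable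
    have hmono := condExp_mono (m := Filtration.piLE (X := fun _ : ℕ => V) n) hint' hint
      (ae_of_all P (Set.indicator_le_indicator_of_subset
        (Set.subset_iUnion (fun n => T n ∩ D n) n) fun _ => zero_le_one))
    filter_upwards [heq, hmono] with X h1 h2 hX
    rw [Set.indicator_of_mem hX] at h1
    exact h1.trans_le h2
  filter_upwards [hlevy, ae_all_iff.2 hbound] with X hX hb hf
  by_contra hcon
  have hXS : X ∉ S := by simpa [hS] using hcon
  rw [Set.indicator_of_notMem hXS] at hX
  obtain ⟨n, hn, hn'⟩ := (hf.and_eventually (hX.eventually (gt_mem_nhds hc'))).exists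
  exact (hb n hn).not_gt hn'

end PathSpace

/-! ### Fresh starts of the walk -/

section Renewal

variable {V : Type*} [AddCommGroup V]

theorem map_shift (φ : V →+ ℝ) (n : ℕ) (X : ℕ → V) (j : ℕ) :
    φ (shift n X j) = φ (X (n + j)) - φ (X n) := map_sub φ _ _

variable [MeasurableSpace V]

/-- The two properties of the annealed law that the 0-1 law rests on: whatever the past, a future
is at most as likely as it is for a fresh walk, and the walk starts afresh when the sites from
which the future steps are taken have not been visited before. -/
structure StartsAfresh (P : Measure (ℕ → V)) : Prop where
  le : ∀ n m x y, P (cyl n x ∩ shift n ⁻¹' cyl m y) ≤ P (cyl m y)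
  eq : ∀ n m x y, (∀ i < n, ∀ j < m, x i ≠ x n + y j) →
    P (cyl n x ∩ shift n ⁻¹' cyl m y) = P (cyl n x) * P (cyl m y)

variable [MeasurableSingletonClass V] [Countable V]

theorem measurable_shift (n : ℕ) : Measurable (shift n : (ℕ → V) → ℕ → V) :=
  measurable_pi_lambda _ fun j => (measurable_of_countable fun p : V × V => p.1 - p.2).comp
    (f := fun X : ℕ → V => (X (n + j), X n))
    ((measurable_pi_apply (n + j)).prodMk (measurable_pi_apply n))

variable {P : Measure (ℕ → V)}

theorem map_restrict_cyl_apply (n : ℕ) (x : ℕ → V) {A : Set (ℕ → V)} (hA : MeasurableSet A) :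
    (P.restrict (cyl n x)).map (shift n) A = P (cyl n x ∩ shift n ⁻¹' A) := by
  rw [Measure.map_apply (measurable_shift n) hA,
    Measure.restrict_apply (measurable_shift n hA), Set.inter_comm]

/-- Almost every path has only cylinders of positive mass, and by `StartsAfresh.le` a piece of a
possible path is possible for a walk starting at time `0`. -/
theorem StartsAfresh.ae_measure_cyl_shift_ne_zero (hP : StartsAfresh P) :
    ∀ᵐ X ∂P, ∀ n m, P (cyl m (shift n X)) ≠ 0 := by
  have h : ∀ᵐ X ∂P, ∀ m, P (cyl m X) ≠ 0 := by
    refine ae_all_iff.2 fun m => ?_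
    change P {X | ¬ P (cyl m X) ≠ 0} = 0
    refine le_zero_iff.1 (measure_le_of_determined (κ' := 0) (n := m) ?_ fun X hX => ?_)
    · intro X Y hXY hX
      have : cyl m Y = cyl m X := by
        ext Z
        exact forall₂_congr fun i hi => by rw [hXY i hi]
      simpa only [Set.mem_ofPred_eq, this] using hX
    · simpa using hX
  filter_upwards [h] with X hX n m h0
  refine hX (n + m) (le_zero_iff.1 ?_)
  refine (measure_mono ?_).trans ((hP.le n m X (shift n X)).trans h0.le)
  refine fun Y hY => ⟨fun i hi => hY i (by omega), fun j hj => ?_⟩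
  simp only [shift, hY (n + j) (by omega), hY n (by omega)]

variable [IsProbabilityMeasure P]

/-- A path that never leaves `H` as seen from its position at some time exists only if the walk
has a chance of never leaving `H`. -/
theorem StartsAfresh.ae_shift_notMem_stay (hP : StartsAfresh P) {H : Set V}
    (hH : P (stay H) = 0) : ∀ᵐ X ∂P, ∀ n, shift n X ∉ stay H := by
  refine ae_all_iff.2 fun n => measure_eq_zero_iff_ae_notMem.1 (le_zero_iff.1 ?_ :
    P (shift n ⁻¹' stay H) = 0)
  -- Comparison with the zero measure sums the bound over all pasts up to time `n`.
  have h := measure_le_of_determined (κ := P.restrict (shift n ⁻¹' stay H)) (κ' := 0) (n := n)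
    (C := Set.univ) (fun _ _ _ _ => trivial) fun x _ => by
      rw [Measure.restrict_apply (measurableSet_cyl n x),
        ← map_restrict_cyl_apply n x (measurableSet_stay H)]
      refine (measure_stay_le (κ' := P) fun m y _ => ?_).trans hH.le
      rw [map_restrict_cyl_apply n x (measurableSet_cyl m y)]
      exact hP.le n m x y
  rwa [Measure.restrict_apply_univ] at h

/-- Infinitely many fresh starts, each with a positive chance of never leaving `H`. -/
theorem StartsAfresh.ae_exists_shift_mem_stay (hP : StartsAfresh P) {H : Set V}
    (hH : P (stay H) ≠ 0) {T : ℕ → Set (ℕ → V)} (hT : ∀ n, Determined n (T n))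
    (hfresh : ∀ n, ∀ X ∈ T n, ∀ i < n, X i - X n ∉ H) :
    ∀ᵐ X ∂P, (∃ᶠ n in atTop, X ∈ T n) → ∃ n, X ∈ T n ∧ shift n X ∈ stay H := by
  refine ae_exists_mem_of_frequently (D := fun n => shift n ⁻¹' stay H) hH hT
    (fun n => measurable_shift n (measurableSet_stay H)) fun n x hx => ?_
  have hcyl : ∀ m y, (∀ j ≤ m, y j ∈ H) →
      (P.restrict (cyl n x)).map (shift n) (cyl m y) = (P (cyl n x) • P) (cyl m y) := by
    intro m y hy
    rw [map_restrict_cyl_apply n x (measurableSet_cyl m y), Measure.smul_apply, smul_eq_mul]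
    refine hP.eq n m x y fun i hi j hj hij => hfresh n x hx i hi ?_
    rw [hij, add_sub_cancel_left]
    exact hy j hj.le
  have : IsFiniteMeasure (P (cyl n x) • P) := P.smul_finite (measure_ne_top _ _)
  rw [← map_restrict_cyl_apply n x (measurableSet_stay H), ← smul_eq_mul, ← Measure.smul_apply]
  exact le_antisymm (measure_stay_le fun m y hy => (hcyl m y hy).le)
    (measure_stay_le fun m y hy => (hcyl m y hy).ge)

/-- Infinitely many fresh starts, each with a positive chance of following the path `y` up to
time `m`. -/
theorem StartsAfresh.ae_exists_shift_mem_cyl (hP : StartsAfresh P) {m : ℕ} {y : ℕ → V}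
    (hy : P (cyl m y) ≠ 0) {T : ℕ → Set (ℕ → V)} (hT : ∀ n, Determined n (T n))
    (hfresh : ∀ n, ∀ X ∈ T n, ∀ i < n, ∀ j < m, X i ≠ X n + y j) :
    ∀ᵐ X ∂P, (∃ᶠ n in atTop, X ∈ T n) → ∃ n, X ∈ T n ∧ shift n X ∈ cyl m y :=
  ae_exists_mem_of_frequently (D := fun n => shift n ⁻¹' cyl m y) hy hT
    (fun n => measurable_shift n (measurableSet_cyl m y))
    fun n x hx => hP.eq n m x y (hfresh n x hx)

end Renewal

/-! ### Records and minima of real sequences -/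

section Records

/-- A sequence has infinitely many strict records along any set of times on which it is
unbounded above. -/
theorem frequently_record {s : ℕ → ℝ} {A : Set ℕ} (h : ¬ BddAbove (s '' A)) :
    ∃ᶠ n in atTop, n ∈ A ∧ ∀ i < n, i ∈ A → s i < s n := by
  classical
  rw [frequently_atTop]
  intro N
  -- The first time in `A` at which `s` exceeds all its values before `N` is a record, and it is not
  -- before `N`.
  obtain ⟨M, hM⟩ := ((Set.finite_Iio N).image s).bddAbove
  have hex : ∃ n, n ∈ A ∧ M < s n := by
    by_contra! hcon
    exact h ⟨M, by rintro _ ⟨n, hn, rfl⟩; exact hcon n hn⟩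
  obtain ⟨h1, h2⟩ := Nat.find_spec hex
  refine ⟨Nat.find hex, ?_, h1, fun i hi hiA => ?_⟩
  · by_contra! hlt
    exact h2.not_ge (hM ⟨_, hlt, rfl⟩)
  · exact (not_lt.1 fun hlt => Nat.find_min hex hi ⟨hiA, hlt⟩).trans_lt h2

theorem exists_forall_le_of_tendsto {s : ℕ → ℝ} (h : Tendsto s atTop atTop) :
    ∃ n, ∀ k, s n ≤ s k := by
  have hfin : {k | s k ≤ s 0}.Finite := by
    obtain ⟨N, hN⟩ := eventually_atTop.1 (h.eventually_gt_atTop (s 0))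
    exact (Set.finite_Iio N).subset fun k hk => not_le.1 fun hNk => (hN k hNk).not_ge hk
  obtain ⟨n, hn, hmin⟩ := hfin.exists_minimalFor s _ ⟨0, le_refl (s 0)⟩
  refine ⟨n, fun k => ?_⟩
  by_cases hk : s k ≤ s 0
  · exact (le_total (s n) (s k)).elim id fun hle => hmin hk hle
  · exact le_trans hn (not_le.1 hk).le

end Records

/-! ### The 0-1 law for walks that start afresh -/

section ZeroOne

variable {V : Type*} [AddCommGroup V] [MeasurableSpace V] [MeasurableSingletonClass V]
  [Countable V] {P : Measure (ℕ → V)}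

/-- A walk that can be transient in the direction `φ` can follow a finite path to any level of `φ`
that remains in the half-space of the lexicographic order for `(φ, ψ)`. -/
theorem StartsAfresh.exists_path (hP : StartsAfresh P) {φ : V →+ ℝ}
    (hφ : ∃ᵐ X ∂P, Tendsto (fun n => φ (X n)) atTop atTop) (ψ : V →+ ℝ) (L : ℝ) :
    ∃ (m : ℕ) (y : ℕ → V), P (cyl m y) ≠ 0 ∧
      (∀ j, 0 ≤ φ (y j) ∧ (φ (y j) = 0 → 0 ≤ ψ (y j))) ∧ L ≤ φ (y m) := by
  obtain ⟨X, hlim, hpos⟩ := (hφ.and_eventually hP.ae_measure_cyl_shift_ne_zero).exists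
  obtain ⟨n₀, hn₀⟩ := exists_forall_le_of_tendsto hlim
  have hfin : {k | φ (X k) = φ (X n₀)}.Finite := by
    obtain ⟨N, hN⟩ := eventually_atTop.1 (hlim.eventually_gt_atTop (φ (X n₀)))
    exact (Set.finite_Iio N).subset fun k hk => not_le.1 fun hNk => (hN k hNk).ne' hk
  -- The path is seen from a lexicographic minimum: transience leaves only finitely many times
  -- minimizing `φ`, and `ψ` is minimized among these.
  obtain ⟨n, hn, hmin⟩ := hfin.exists_minimalFor (fun k => ψ (X k)) _ ⟨n₀, rfl⟩
  have hn' : φ (X n) = φ (X n₀) := hn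
  obtain ⟨N, hN⟩ := eventually_atTop.1 (hlim.eventually_ge_atTop (φ (X n) + L))
  refine ⟨N, shift n X, hpos n N, fun j => ?_, ?_⟩
  · rw [map_shift, map_shift, sub_nonneg, sub_nonneg, sub_eq_zero, hn']
    exact ⟨hn₀ _, fun h => (le_total (ψ (X n)) (ψ (X (n + j)))).elim id fun hle => hmin h hle⟩
  · rw [map_shift, le_sub_iff_add_le']
    exact hN _ (by omega)

/-- Where `a j > 0`, every small `ε` works by continuity; where `a j = 0`, every `ε > 0` does.
Finitely many `j` allow a common choice, tilting the lexicographic half-space into an ordinary one.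
-/
theorem exists_pos_forall_add_mul_nonneg {a b : ℕ → ℝ}
    (h : ∀ j, 0 ≤ a j ∧ (a j = 0 → 0 ≤ b j)) (m : ℕ) :
    ∃ ε > 0, ∀ j < m, 0 ≤ a j + ε * b j := by
  have hev : ∀ᶠ ε in nhdsWithin (0 : ℝ) (Set.Ioi 0), ∀ j ∈ Set.Iio m, 0 ≤ a j + ε * b j := by
    refine (eventually_all_finite (Set.finite_Iio m)).2 fun j _ => ?_
    rcases (h j).1.eq_or_lt with h0 | h0
    · filter_upwards [self_mem_nhdsWithin] with ε hε
      rw [← h0, zero_add]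
      exact mul_nonneg (le_of_lt hε) ((h j).2 h0.symm)
    · have hcont : Tendsto (fun ε : ℝ => a j + ε * b j) (nhds 0) (nhds (a j + 0 * b j)) :=
        Continuous.tendsto (by fun_prop) 0
      rw [zero_mul, add_zero] at hcont
      exact ((hcont.eventually (lt_mem_nhds h0)).mono fun _ => le_of_lt).filter_mono
        nhdsWithin_le_nhds
  obtain ⟨ε, hε, hpos⟩ := (hev.and self_mem_nhdsWithin).exists
  exact ⟨ε, hpos, hε⟩

variable [IsProbabilityMeasure P]

/-- If the walk can stay in a half-space, then it is transient in the direction of that half-space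
as soon as it is unbounded in this direction. -/
theorem StartsAfresh.ae_tendsto_of_not_bddAbove (hP : StartsAfresh P) {φ : V →+ ℝ}
    (hφ : P (stay {v | 0 ≤ φ v}) ≠ 0) :
    ∀ᵐ X ∂P, ¬ BddAbove (Set.range fun n => φ (X n)) →
      Tendsto (fun n => φ (X n)) atTop atTop := by
  have key : ∀ L : ℕ, ∀ᵐ X ∂P, ¬ BddAbove (Set.range fun n => φ (X n)) →
      ∀ᶠ n in atTop, (L : ℝ) ≤ φ (X n) := by
    intro L
    filter_upwards [hP.ae_exists_shift_mem_stay hφ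
      (T := fun n => {X | L ≤ φ (X n) ∧ ∀ i < n, L ≤ φ (X i) → φ (X i) < φ (X n)})
      (fun n X Y h hX => ⟨h n le_rfl ▸ hX.1, fun i hi => h n le_rfl ▸ h i hi.le ▸ hX.2 i hi⟩)
      (fun n X hX i hi hmem => by
        have h1 : φ (X n) ≤ φ (X i) := by simpa using hmem
        exact (hX.2 i hi (hX.1.trans h1)).not_ge h1)] with X hX hub
    obtain ⟨n, hn, hstay⟩ := hX (frequently_record (s := fun n => φ (X n))
      (A := {n | L ≤ φ (X n)}) fun ⟨M, hM⟩ => hub ⟨max M L, by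
        rintro _ ⟨k, rfl⟩
        by_cases hk : L ≤ φ (X k)
        · exact (hM ⟨k, hk, rfl⟩).trans (le_max_left _ _)
        · exact (not_le.1 hk).le.trans (le_max_right _ _)⟩)
    filter_upwards [eventually_ge_atTop n] with k hk
    obtain ⟨j, rfl⟩ := Nat.exists_eq_add_of_le hk
    have := hstay j
    simp only [Set.mem_ofPred_eq, map_shift, sub_nonneg] at this
    exact hn.1.trans this
  filter_upwards [ae_all_iff.2 key] with X hX hub
  refine tendsto_atTop.2 fun b => ?_
  obtain ⟨L, hL⟩ := exists_nat_ge b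
  exact (hX L hub).mono fun n hn => hL.trans hn

/-- A walk that can be transient in some direction never gets stuck in a finite set. -/
theorem StartsAfresh.ae_infinite_range (hP : StartsAfresh P) {φ : V →+ ℝ}
    (hφ : ∃ᵐ X ∂P, Tendsto (fun n => φ (X n)) atTop atTop) :
    ∀ᵐ X ∂P, (Set.range X).Infinite := by
  -- If the walk could stay in `H` forever, then a record of `φ` along a transient path would trap
  -- it in a translate of the finite set `H`.
  have hnull : ∀ H : Finset V, (∀ v ∈ H, 0 ≤ φ v) → P (stay (H : Set V)) = 0 := by
    intro H hH
    by_contra hpos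
    refine hφ ?_
    filter_upwards [hP.ae_exists_shift_mem_stay hpos
      (T := fun n => {X | ∀ i < n, φ (X i) < φ (X n)})
      (fun n X Y h hX i hi => h n le_rfl ▸ h i hi.le ▸ hX i hi)
      (fun n X hX i hi hmem => by
        have := hH _ hmem
        rw [map_sub, sub_nonneg] at this
        exact (hX i hi).not_ge this)] with X hX hlim
    have hunb : ¬ BddAbove ((fun n => φ (X n)) '' Set.univ) := by
      rw [Set.image_univ]; exact not_bddAbove_of_tendsto_atTop hlim
    obtain ⟨n, -, hstay⟩ := hX ((frequently_record hunb).mono fun n hn i hi => hn.2 i hi trivial)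
    obtain ⟨M, hM⟩ := (H.finite_toSet.image φ).bddAbove
    obtain ⟨N, hN⟩ := eventually_atTop.1 (hlim.eventually_gt_atTop (φ (X n) + M))
    have h1 := hM ⟨_, hstay N, rfl⟩
    rw [map_shift] at h1
    linarith [hN (n + N) (by omega)]
  have hcount : ∀ᵐ X ∂P, ∀ H : Finset V, (∀ v ∈ H, 0 ≤ φ v) → ∀ n, shift n X ∉ stay (H : Set V) :=
    ae_all_iff.2 fun H => by
      by_cases hH : ∀ v ∈ H, 0 ≤ φ v
      · filter_upwards [hP.ae_shift_notMem_stay (hnull H hH)] with X hX _ using hX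
      · exact ae_of_all _ fun X h => absurd h hH
  filter_upwards [hcount] with X hX hfin
  obtain ⟨_, ⟨n, rfl⟩, hmin⟩ := hfin.exists_minimalFor φ _ (Set.range_nonempty X)
  refine hX (hfin.image (· - X n)).toFinset ?_ n fun j => ?_
  · intro v hv
    simp only [Set.Finite.mem_toFinset, Set.mem_image, Set.mem_range, exists_exists_eq_and] at hv
    obtain ⟨k, rfl⟩ := hv
    rw [map_sub, sub_nonneg]
    exact (le_total (φ (X n)) (φ (X k))).elim id fun hle => hmin ⟨k, rfl⟩ hle
  · simp only [Set.Finite.coe_toFinset]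
    exact ⟨_, ⟨n + j, rfl⟩, rfl⟩

/-- A walk that can be transient in the direction `φ` does not spread out within a strip
`u ≤ φ < v` without ever going above it. -/
theorem StartsAfresh.ae_bddAbove_strip (hP : StartsAfresh P) {φ : V →+ ℝ}
    (hφ : ∃ᵐ X ∂P, Tendsto (fun n => φ (X n)) atTop atTop) (ψ : V →+ ℝ) :
    ∀ᵐ X ∂P, BddAbove (Set.range fun n => φ (X n)) →
      ∀ u : ℝ, BddAbove ((fun n => ψ (X n)) '' {n | u ≤ φ (X n)}) := by
  have key : ∀ k : ℕ, ∀ᵐ X ∂P, (∀ n, φ (X n) < k) →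
      BddAbove ((fun n => ψ (X n)) '' {n | -(k : ℝ) ≤ φ (X n)}) := by
    intro k
    -- A climb of `2k` from a level at least `-k` violates `φ < k`.
    obtain ⟨m, y, hy, hlex, hL⟩ := hP.exists_path hφ ψ (k + k)
    obtain ⟨ε, hε, hnn⟩ := exists_pos_forall_add_mul_nonneg hlex m
    filter_upwards [hP.ae_exists_shift_mem_cyl hy
      (T := fun n => {X | -(k : ℝ) ≤ φ (X n) ∧ ∀ i < n, -(k : ℝ) ≤ φ (X i) →
        φ (X i) + ε * ψ (X i) < φ (X n) + ε * ψ (X n)})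
      (fun n X Y h hX => ⟨h n le_rfl ▸ hX.1, fun i hi => h n le_rfl ▸ h i hi.le ▸ hX.2 i hi⟩)
      -- A past site met by the attempt would have level at least `-k`, hence compete for the
      -- record, yet have `φ + εψ` no smaller than at the record.
      (fun n X hX i hi j hj heq => by
        have h1 := hX.2 i hi (by rw [heq, map_add]; linarith [hX.1, (hlex j).1])
        rw [heq, map_add, map_add, mul_add] at h1
        linarith [hnn j hj])] with X hX hlt
    by_contra hunb
    obtain ⟨n, hn, hcyl⟩ := hX (frequently_record (s := fun n => φ (X n) + ε * ψ (X n))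
      -- In the strip, `φ + εψ ≤ M` gives `εψ ≤ M + k`, so unboundedness of `ψ` passes to `φ + εψ`.
      (A := {n | -(k : ℝ) ≤ φ (X n)}) fun ⟨M, hM⟩ => hunb ⟨(M + k) / ε, by
        rintro _ ⟨i, hi, rfl⟩
        have h1 : φ (X i) + ε * ψ (X i) ≤ M := hM ⟨i, hi, rfl⟩
        have h2 : -(k : ℝ) ≤ φ (X i) := hi
        rw [le_div_iff₀ hε]
        linarith⟩)
    have h1 := congrArg φ (hcyl m le_rfl)
    rw [map_shift] at h1
    linarith [hlt (n + m), hn.1]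
  filter_upwards [ae_all_iff.2 key] with X hX hbdd u
  obtain ⟨M, hM⟩ := hbdd
  obtain ⟨k, hk⟩ := exists_nat_gt (max M (-u))
  refine (hX k fun n => ?_).mono (Set.image_mono fun n hn => ?_)
  · exact (hM ⟨n, rfl⟩).trans_lt ((le_max_left _ _).trans_lt hk)
  · have := (le_max_right M (-u)).trans_lt hk
    exact le_trans (by linarith) (show u ≤ φ (X n) from hn)

/-- If the walk has a chance of being transient in the direction `φ`, then almost surely it is
transient in this direction or in the opposite one. -/
theorem StartsAfresh.ae_tendsto_or_tendsto (hP : StartsAfresh P) {φ : V →+ ℝ}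
    (hφ : ∃ᵐ X ∂P, Tendsto (fun n => φ (X n)) atTop atTop) {ι : Type*} [Countable ι]
    {ψ : ι → V →+ ℝ} (hψ : ∀ S : Set V, (∀ i, BddAbove (ψ i '' S)) → S.Finite) :
    ∀ᵐ X ∂P, Tendsto (fun n => φ (X n)) atTop atTop ∨ Tendsto (fun n => φ (X n)) atTop atBot := by
  have hplus : P (stay {v | 0 ≤ φ v}) ≠ 0 := by
    refine fun h0 => hφ ?_
    filter_upwards [hP.ae_shift_notMem_stay h0] with X hX hlim
    obtain ⟨n, hn⟩ := exists_forall_le_of_tendsto hlim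
    refine hX n fun j => ?_
    rw [Set.mem_ofPred_eq, map_shift, sub_nonneg]
    exact hn _
  -- If staying in `{φ ≤ 0}` has probability zero, a maximum of `φ` is almost surely never attained;
  -- otherwise the half-space argument applies to `-φ`.
  have hminus : ∀ᵐ X ∂P, (∃ n, ∀ k, φ (X k) ≤ φ (X n)) →
      ¬ BddBelow (Set.range fun n => φ (X n)) → Tendsto (fun n => φ (X n)) atTop atBot := by
    by_cases h0 : P (stay {v | 0 ≤ (-φ) v}) = 0
    · filter_upwards [hP.ae_shift_notMem_stay h0] with X hX ⟨n, hn⟩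
      refine absurd (fun j => ?_) (hX n)
      rw [Set.mem_ofPred_eq, map_shift, AddMonoidHom.neg_apply, AddMonoidHom.neg_apply]
      linarith [hn (n + j)]
    · filter_upwards [hP.ae_tendsto_of_not_bddAbove h0] with X hX _ hunb
      refine tendsto_neg_atTop_iff.1 (hX fun ⟨M, hM⟩ => hunb ⟨-M, ?_⟩)
      rintro _ ⟨n, rfl⟩
      exact neg_le.1 (hM ⟨n, rfl⟩)
  filter_upwards [hP.ae_tendsto_of_not_bddAbove hplus, hP.ae_infinite_range hφ, hminus,
    ae_all_iff.2 fun i => hP.ae_bddAbove_strip hφ (ψ i)] with X h1 h2 h3 h4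
  by_cases hbdd : BddAbove (Set.range fun n => φ (X n))
  swap
  · exact Or.inl (h1 hbdd)
  refine or_iff_not_imp_right.2 fun hnot => absurd hnot (not_not.2 ?_)
  have hfin : ∀ u, (X '' {n | u ≤ φ (X n)}).Finite := fun u => hψ _ fun i => by
    rw [Set.image_image]; exact h4 i hbdd u
  by_contra hbot
  rw [tendsto_atBot] at hbot
  push Not at hbot
  obtain ⟨u, hu⟩ := hbot
  obtain ⟨n₁, hn₁⟩ := hu.exists
  -- The choice of `u` makes this finite set of sites nonempty, so its maximum is a global one.
  obtain ⟨_, ⟨n, hn, rfl⟩, hmax⟩ := (hfin u).exists_maximalFor φ _ ⟨_, n₁, hn₁.le, rfl⟩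
  have hmax' : ∀ k, φ (X k) ≤ φ (X n) := fun k =>
    (le_total (φ (X k)) (φ (X n))).elim id fun hle =>
      hmax ⟨k, le_trans (show u ≤ φ (X n) from hn) hle, rfl⟩ hle
  by_cases hbb : BddBelow (Set.range fun n => φ (X n))
  · obtain ⟨l, hl⟩ := hbb
    refine h2 ((hfin l).subset ?_)
    rintro _ ⟨k, rfl⟩
    exact ⟨k, hl ⟨k, rfl⟩, rfl⟩
  · obtain ⟨k, hk, hk'⟩ := (hu.and_eventually
      ((h3 ⟨n, hmax'⟩ hbb).eventually_le_atBot u)).exists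
    exact hk.not_ge hk'

end ZeroOne

/-! ### Path probabilities and fresh starts under the annealed law -/

section Annealed

variable {d : ℕ}

/-- The product of the probabilities of the first `n` steps of the path `x`. -/
noncomputable def pathProb (ω : Env d) (n : ℕ) (x : ℕ → Lattice d) : ENNReal :=
  ∏ i ∈ Finset.range n, stepKernel ω (x i) {x (i + 1)}

theorem partialTraj_singleton (ω : Env d) (n : ℕ) (x : ℕ → Lattice d) (hx : x 0 = 0) :
    Kernel.partialTraj (X := fun _ => Lattice d) (histKernel ω) 0 n (fun _ => 0)
      {Preorder.frestrictLe n x} = pathProb ω n x := by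
  induction n with
  | zero =>
    rw [Kernel.partialTraj_self, Kernel.id_apply, Measure.dirac_apply' _ (measurableSet_singleton _),
      Set.indicator_of_mem, pathProb, Finset.range_zero, Finset.prod_empty, Pi.one_apply]
    refine funext fun i => ?_
    obtain ⟨i, hi⟩ := i
    obtain rfl : i = 0 := Nat.le_zero.1 (Finset.mem_Iic.1 hi)
    exact hx.symm
  | succ n ih =>
    have hs : MeasurableSet {Preorder.frestrictLe (π := fun _ : ℕ => Lattice d) (n + 1) x} :=
      measurableSet_singleton _
    have hstep : ∀ y : (i : Finset.Iic n) → Lattice d,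
        Kernel.partialTraj (X := fun _ => Lattice d) (histKernel ω) n (n + 1) y
          {Preorder.frestrictLe (n + 1) x} =
        ({Preorder.frestrictLe n x} : Set ((i : Finset.Iic n) → Lattice d)).indicator
          (fun _ => stepKernel ω (x n) {x (n + 1)}) y := by
      intro y
      have hm := measurable_IicProdIoc (X := fun _ : ℕ => Lattice d) (m := n) (n := n + 1)
      have hp := (MeasurableEquiv.piSingleton (X := fun _ : ℕ => Lattice d) n).measurable
      rw [Kernel.partialTraj_succ_self, Kernel.map_apply' _ hm _ hs,
        Kernel.id_prod_apply' _ _ (hm hs),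
        Kernel.map_apply' _ hp _ (measurable_prodMk_left (hm hs))]
      have hset : ∀ z : Lattice d,
          z ∈ (MeasurableEquiv.piSingleton (X := fun _ : ℕ => Lattice d) n) ⁻¹'
            (Prod.mk y ⁻¹' (IicProdIoc (X := fun _ : ℕ => Lattice d) n (n + 1) ⁻¹'
              {Preorder.frestrictLe (n + 1) x})) ↔
          y = Preorder.frestrictLe n x ∧ z = x (n + 1) := by
        intro z
        simp only [Set.mem_preimage, Set.mem_singleton_iff]
        refine ⟨fun h => ⟨funext fun ⟨i, hi⟩ => ?_, ?_⟩, fun h => funext fun ⟨i, hi⟩ => ?_⟩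
        · have hi' := Finset.mem_Iic.1 hi
          simpa [IicProdIoc, hi'] using congrFun h ⟨i, Finset.mem_Iic.2 (hi'.trans n.le_succ)⟩
        · simpa [IicProdIoc, MeasurableEquiv.piSingleton] using
            congrFun h ⟨n + 1, Finset.mem_Iic.2 le_rfl⟩
        · by_cases hin : i ≤ n
          · simpa [IicProdIoc, hin] using congrFun h.1 ⟨i, Finset.mem_Iic.2 hin⟩
          · obtain rfl : i = n + 1 := by have := Finset.mem_Iic.1 hi; omega
            simp [IicProdIoc, MeasurableEquiv.piSingleton, h.2]
      by_cases hy : y = Preorder.frestrictLe n x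
      · rw [Set.indicator_of_mem (Set.mem_singleton_iff.2 hy)]
        subst hy
        change stepKernel ω (x n) _ = _
        congr 1
        ext z
        rw [hset, Set.mem_singleton_iff]
        exact and_iff_right rfl
      · rw [Set.indicator_of_notMem (by simpa using hy)]
        convert measure_empty (μ := histKernel ω n y)
        ext z
        rw [hset]
        simp [hy]
    rw [Kernel.partialTraj_succ_eq_comp (Nat.zero_le n), Kernel.comp_apply' _ _ _ hs]
    simp only [hstep]
    rw [lintegral_indicator_const (measurableSet_singleton _), ih, pathProb, pathProb,
      Finset.prod_range_succ, mul_comm]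

theorem quenched_cyl (ω : Env d) (n : ℕ) {x : ℕ → Lattice d} (hx : x 0 = 0) :
    quenched ω (cyl n x) = pathProb ω n x := by
  rw [← partialTraj_singleton ω n x hx, ← Kernel.traj_map_frestrictLe_apply,
    Measure.map_apply (Preorder.measurable_frestrictLe n) (measurableSet_singleton _),
    cyl_eq_preimage]
  rfl

theorem quenched_cyl_of_ne (ω : Env d) (n : ℕ) {x : ℕ → Lattice d} (hx : x 0 ≠ 0) :
    quenched ω (cyl n x) = 0 := by
  have h0 : quenched ω (cyl 0 fun _ => 0) = 1 := by
    rw [quenched_cyl ω 0 rfl, pathProb, Finset.range_zero, Finset.prod_empty]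
  refine measure_mono_null (fun X hX => ?_) ((prob_compl_eq_zero_iff (measurableSet_cyl _ _)).2 h0)
  exact fun h => hx ((hX 0 (Nat.zero_le n)).symm.trans (h 0 le_rfl))

/-- Only the sites from which a step is taken matter, so the endpoint `x n` need not lie in `S`. -/
theorem measurable_pathProb_iSup (n : ℕ) (x : ℕ → Lattice d) {S : Set (Lattice d)}
    (hS : ∀ i < n, x i ∈ S) :
    Measurable[⨆ u ∈ S, MeasurableSpace.comap (fun ω : Env d => ω u) inferInstance]
      fun ω : Env d => pathProb ω n x := by
  refine Finset.measurable_prod _ fun i hi => ?_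
  have h1 : Measurable fun p : ProbabilityMeasure (Dir d) =>
      (p : Measure (Dir d)).map (fun e => x i + e.vec) {x (i + 1)} :=
    (Measure.measurable_coe (measurableSet_singleton _)).comp
      ((Measure.measurable_map _ (measurable_of_countable _)).comp measurable_subtype_coe)
  have h2 : Measurable[MeasurableSpace.comap (fun ω : Env d => ω (x i)) inferInstance]
      fun ω : Env d => ω (x i) := comap_measurable _
  exact (h1.comp h2).mono (le_iSup₂_of_le (x i) (hS i (Finset.mem_range.1 hi)) le_rfl) le_rfl

theorem comap_eval_le (u : Lattice d) :
    MeasurableSpace.comap (fun ω : Env d => ω u) inferInstance ≤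
      (inferInstance : MeasurableSpace (Env d)) :=
  (measurable_pi_apply u).comap_le

theorem measurable_pathProb (n : ℕ) (x : ℕ → Lattice d) :
    Measurable fun ω : Env d => pathProb ω n x :=
  (measurable_pathProb_iSup n x (S := Set.univ) fun _ _ => trivial).mono
    (iSup₂_le fun u _ => comap_eval_le u) le_rfl

theorem stepKernel_translate (ω : Env d) (a v w : Lattice d) :
    stepKernel ω (a + v) {a + w} = stepKernel (fun u => ω (a + u)) v {w} := by
  rw [stepKernel_apply, stepKernel_apply,
    Measure.map_apply (measurable_of_countable _) (measurableSet_singleton _),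
    Measure.map_apply (measurable_of_countable _) (measurableSet_singleton _)]
  congr 1
  ext e
  simp [add_assoc]

theorem pathProb_translate (ω : Env d) (a : Lattice d) (n : ℕ) (x : ℕ → Lattice d) :
    pathProb ω n (fun j => a + x j) = pathProb (fun u => ω (a + u)) n x :=
  Finset.prod_congr rfl fun _ _ => stepKernel_translate ω a _ _

theorem pathProb_le_one (ω : Env d) (n : ℕ) (x : ℕ → Lattice d) : pathProb ω n x ≤ 1 :=
  Finset.prod_le_one' fun _ _ => prob_le_one

variable (μ : Measure (ProbabilityMeasure (Dir d))) [IsProbabilityMeasure μ]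

instance : IsProbabilityMeasure (envLaw μ) := by
  unfold envLaw; infer_instance

instance : IsProbabilityMeasure (annealed μ) :=
  ⟨by rw [annealed, Measure.bind_apply .univ measurable_quenched.aemeasurable]; simp⟩

theorem annealed_cyl (n : ℕ) {x : ℕ → Lattice d} (hx : x 0 = 0) :
    annealed μ (cyl n x) = ∫⁻ ω, pathProb ω n x ∂envLaw μ := by
  rw [annealed, Measure.bind_apply (measurableSet_cyl n x) measurable_quenched.aemeasurable]
  simp only [quenched_cyl _ n hx]

theorem annealed_cyl_of_ne (n : ℕ) {x : ℕ → Lattice d} (hx : x 0 ≠ 0) :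
    annealed μ (cyl n x) = 0 := by
  rw [annealed, Measure.bind_apply (measurableSet_cyl n x) measurable_quenched.aemeasurable]
  simp only [quenched_cyl_of_ne _ n hx, lintegral_zero]

/-- The i.i.d. environment is invariant under translations of the lattice. -/
theorem lintegral_pathProb_translate (a : Lattice d) (n : ℕ) (x : ℕ → Lattice d) :
    ∫⁻ ω, pathProb ω n (fun j => a + x j) ∂envLaw μ = ∫⁻ ω, pathProb ω n x ∂envLaw μ := by
  have hmap : (envLaw μ).map (fun ω u => ω (a + u)) = envLaw μ :=
    Measure.map_infinitePi_infinitePi_of_inj (P := fun _ : Lattice d => μ) (add_right_injective a)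
  conv_rhs => rw [← hmap]
  rw [lintegral_map (measurable_pathProb n x) (by fun_prop)]
  simp only [pathProb_translate]

/-- The two products read the environment on disjoint sets of sites, where it is independent. -/
theorem lintegral_pathProb_mul {n m : ℕ} {x y : ℕ → Lattice d}
    (h : ∀ i < n, ∀ j < m, x i ≠ y j) :
    ∫⁻ ω, pathProb ω n x * pathProb ω m y ∂envLaw μ =
      (∫⁻ ω, pathProb ω n x ∂envLaw μ) * ∫⁻ ω, pathProb ω m y ∂envLaw μ := by
  have hind : iIndep (fun u : Lattice d =>
      MeasurableSpace.comap (fun ω : Env d => ω u) inferInstance) (envLaw μ) :=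
    (iIndepFun_iff_iIndep _ _ _).1
      (iIndepFun_infinitePi (P := fun _ : Lattice d => μ) (X := fun _ p => p)
        fun _ => measurable_id)
  have hdisj : Disjoint (x '' Set.Iio n) (y '' Set.Iio m) := by
    rw [Set.disjoint_left]
    rintro _ ⟨i, hi, rfl⟩ ⟨j, hj, hij⟩
    exact h i hi j hj hij.symm
  exact lintegral_mul_eq_lintegral_mul_lintegral_of_independent_measurableSpace
    (iSup₂_le fun u _ => comap_eval_le u) (iSup₂_le fun u _ => comap_eval_le u)
    (indep_iSup_of_disjoint comap_eval_le hind hdisj)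
    (measurable_pathProb_iSup n x fun i hi => ⟨i, hi, rfl⟩)
    (measurable_pathProb_iSup m y fun j hj => ⟨j, hj, rfl⟩)

/-- A cylinder event for the past together with one for the future, for a walk that is at the
origin at time `0`. -/
theorem annealed_cyl_inter_shift (n m : ℕ) {x y : ℕ → Lattice d} (hx : x 0 = 0) (hy : y 0 = 0) :
    annealed μ (cyl n x ∩ shift n ⁻¹' cyl m y) =
      ∫⁻ ω, pathProb ω n x * pathProb ω m (fun j => x n + y j) ∂envLaw μ := by
  -- Past and future glue to a single path, which turns the event into one cylinder.
  set z : ℕ → Lattice d := fun k => if k ≤ n then x k else x n + y (k - n) with hz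
  have hz1 : ∀ i ≤ n, z i = x i := fun i hi => if_pos hi
  have hz2 : ∀ j, z (n + j) = x n + y j := by
    intro j
    rcases Nat.eq_zero_or_pos j with rfl | hj
    · rw [add_zero, hz1 n le_rfl, hy, add_zero]
    · rw [hz]
      simp only [show ¬ n + j ≤ n by omega, if_false, Nat.add_sub_cancel_left]
  have hset : cyl n x ∩ shift n ⁻¹' cyl m y = cyl (n + m) z := by
    ext X
    refine ⟨fun ⟨h1, h2⟩ k hk => ?_, fun h => ⟨fun i hi => ?_, fun j hj => ?_⟩⟩
    · rcases le_total k n with hkn | hkn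
      · rw [h1 k hkn, hz1 k hkn]
      · obtain ⟨j, rfl⟩ := Nat.exists_eq_add_of_le hkn
        rw [hz2, ← h2 j (by omega), ← h1 n le_rfl, shift, add_sub_cancel]
    · rw [h i (by omega), hz1 i hi]
    · rw [shift, h (n + j) (by omega), h n (by omega), hz2, hz1 n le_rfl, add_sub_cancel_left]
  rw [hset, annealed_cyl μ _ ((hz1 0 (Nat.zero_le n)).trans hx)]
  refine lintegral_congr fun ω => ?_
  simp only [pathProb]
  rw [Finset.prod_range_add]
  congr 1
  · refine Finset.prod_congr rfl fun i hi => ?_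
    rw [hz1 i (Finset.mem_range.1 hi).le, hz1 (i + 1) (Finset.mem_range.1 hi)]
  · refine Finset.prod_congr rfl fun j _ => ?_
    rw [add_assoc, hz2, hz2]

/-- For the inequality, the past factor is at most one and the future factor is translated to the
origin. For the equality, disjointness of the sites makes the two factors independent. -/
theorem startsAfresh_annealed : StartsAfresh (annealed μ) := by
  have hempty : ∀ n m (x y : ℕ → Lattice d), y 0 ≠ 0 → cyl n x ∩ shift n ⁻¹' cyl m y = ∅ := by
    intro n m x y hy
    refine Set.eq_empty_of_forall_notMem fun X hX => hy ?_
    rw [← hX.2 0 (Nat.zero_le m), shift, add_zero, sub_self]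
  refine ⟨fun n m x y => ?_, fun n m x y h => ?_⟩
  · by_cases hy : y 0 = 0
    swap
    · rw [hempty n m x y hy, measure_empty]
      exact zero_le
    by_cases hx : x 0 = 0
    swap
    · refine (measure_mono Set.inter_subset_left).trans ?_
      rw [annealed_cyl_of_ne μ n hx]
      exact zero_le
    rw [annealed_cyl_inter_shift μ n m hx hy, annealed_cyl μ m hy,
      ← lintegral_pathProb_translate μ (x n)]
    exact lintegral_mono fun ω => mul_le_of_le_one_left' (pathProb_le_one ω n x)
  · by_cases hy : y 0 = 0
    swap
    · rw [hempty n m x y hy, measure_empty, annealed_cyl_of_ne μ m hy, mul_zero]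
    by_cases hx : x 0 = 0
    swap
    · rw [annealed_cyl_of_ne μ n hx, zero_mul]
      exact measure_mono_null Set.inter_subset_left (annealed_cyl_of_ne μ n hx)
    rw [annealed_cyl_inter_shift μ n m hx hy, lintegral_pathProb_mul μ h,
      lintegral_pathProb_translate, annealed_cyl μ n hx, annealed_cyl μ m hy]

/-- The inner product with `ℓ` as an additive map. -/
noncomputable def dotHom (ℓ : Fin d → ℝ) : Lattice d →+ ℝ where
  toFun v := dot v ℓ
  map_zero' := by simp [dot]
  map_add' v w := by simp [dot, add_mul, Finset.sum_add_distrib]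

theorem dotHom_apply (ℓ : Fin d → ℝ) (v : Lattice d) : dotHom ℓ v = dot v ℓ := rfl

/-- The signed coordinate of a lattice point in the direction `e`. -/
noncomputable def signedCoord (e : Dir d) : Lattice d →+ ℝ :=
  dotHom fun i => if i = e.1 then (if e.2 then 1 else -1) else 0

/-- Bounds on all signed coordinates confine `S` to a finite box; this lets finitely many directions
`ψ` control the sites visited in a strip. -/
theorem finite_of_bddAbove_signedCoord (S : Set (Lattice d))
    (h : ∀ e : Dir d, BddAbove (signedCoord e '' S)) : S.Finite := by
  choose M hM using h
  refine (Set.finite_Icc (fun i => -⌈M (i, false)⌉) fun i => ⌈M (i, true)⌉).subset fun v hv => ?_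
  refine ⟨fun i => ?_, fun i => ?_⟩
  · have h1 := hM (i, false) ⟨v, hv, rfl⟩
    simp only [signedCoord, dotHom_apply, dot, mul_ite, mul_zero, Finset.sum_ite_eq',
      Finset.mem_univ, if_true, Bool.false_eq_true, if_false] at h1
    have h2 : (-(v i : ℝ)) ≤ ⌈M (i, false)⌉ := by linarith [Int.le_ceil (M (i, false))]
    have h3 : -(v i) ≤ ⌈M (i, false)⌉ := by exact_mod_cast h2
    exact neg_le.1 h3
  · have h1 := hM (i, true) ⟨v, hv, rfl⟩
    simp only [signedCoord, dotHom_apply, dot, mul_ite, mul_zero, Finset.sum_ite_eq',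
      Finset.mem_univ, if_true, mul_one] at h1
    exact_mod_cast h1.trans (Int.le_ceil (M (i, true)))

theorem annealed_eventPlus_union_eventMinus {ℓ : Fin d → ℝ}
    (h : annealed μ (eventPlus ℓ) ≠ 0) : annealed μ (eventPlus ℓ ∪ eventMinus ℓ) = 1 := by
  have hae := (startsAfresh_annealed μ).ae_tendsto_or_tendsto (φ := dotHom ℓ)
    (frequently_ae_mem_iff.2 h) finite_of_bddAbove_signedCoord
  have hmem : eventPlus ℓ ∪ eventMinus ℓ ∈ ae (annealed μ) := hae
  rw [measure_congr (eventuallyEq_univ.2 hmem), measure_univ]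

theorem dot_neg (v : Lattice d) (ℓ : Fin d → ℝ) : dot v (-ℓ) = -dot v ℓ := by
  simp [dot]

theorem eventPlus_neg (ℓ : Fin d → ℝ) : eventPlus (-ℓ) = eventMinus ℓ := by
  ext X
  simp only [eventPlus, eventMinus, dot_neg, Set.mem_ofPred_eq, tendsto_neg_atTop_iff]

end Annealed

end RWRE

/-- Kalikow's 0-1 law for random walks in i.i.d. random environments, without ellipticity. -/
theorem mainTheorem2 (d : ℕ) (hd : 2 ≤ d)
    (μ : MeasureTheory.Measure (MeasureTheory.ProbabilityMeasure (RWRE.Dir d)))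
    [MeasureTheory.IsProbabilityMeasure μ] (ℓ : Fin d → ℝ) (hℓ : ℓ ≠ 0) :
    RWRE.annealed μ (RWRE.eventPlus ℓ ∪ RWRE.eventMinus ℓ) = 0 ∨
      RWRE.annealed μ (RWRE.eventPlus ℓ ∪ RWRE.eventMinus ℓ) = 1 := by
  by_cases hplus : RWRE.annealed μ (RWRE.eventPlus ℓ) = 0
  · by_cases hminus : RWRE.annealed μ (RWRE.eventMinus ℓ) = 0
    · exact Or.inl (MeasureTheory.measure_union_null hplus hminus)
    · refine Or.inr ?_
      have h := RWRE.annealed_eventPlus_union_eventMinus μ (ℓ := -ℓ)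
        (by rwa [RWRE.eventPlus_neg])
      rwa [← RWRE.eventPlus_neg (-ℓ), neg_neg, RWRE.eventPlus_neg, Set.union_comm] at h
  · exact Or.inr (RWRE.annealed_eventPlus_union_eventMinus μ hplus)
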